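/- Let $\mathbf{k}$ be a field, let $X=\{x_1<\dots<x_n\}$ be a finite ordered set with $n\ge 2$, let $d\ge 2$, and let $r:X\times X\to X\times X$, $r(x,y)=({}^xy,x^y)$, be a left-nondegenerate idempotent solution of the Yang--Baxter equation: $r^{12}r^{23}r^{12}=r^{23}r^{12}r^{23}$ on $X^3$, $r^2=r$, and $y\mapsto{}^xy$ is bijective for every $x\in X$ ($r$ is not assumed bijective). Let $\mathcal A=\mathcal A(\mathbf{k},X,r)=\mathbf{k}\langle X\rangle/I$ be its Yang--Baxter algebra, where $I$ is the two-sided ideal generated by all $xy-y'x'$ with $r(x,y)=(y',x')\neq(x,y)$. It is graded by length, $\mathcal A=\bigoplus_m\mathcal A_m$, and $\mathcal A^{(d)}=\bigoplus_m\mathcal A_{md}$ is its $d$-Veronese subalgebra, with degree-$m$ component $\mathcal A_{md}$. With respect to the degree-lexicographic order on words, let $\mathcal N_d$ be the set of words of length $d$ that are normal modulo $I$, and for a word $w$ let $\mathrm{Nor}(w)$ be the unique normal word with $w-\mathrm{Nor}(w)\in I$. Extend the actions of $X$ on $X$ to words by $${}^{ab}u={}^a({}^bu),\quad {}^a(uv)=({}^au)({}^{a^u}v),\quad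 a^{uv}=(a^u)^v,\quad (ab)^u=(a^{{}^bu})(b^u),$$ the empty word acting trivially, and let $\rho_d(a,b)=(\mathrm{Nor}({}^ab),\mathrm{Nor}(a^b))$ on $\mathcal N_d\times\mathcal N_d$. Then: (a) $(\mathcal N_d,\rho_d)$ is a left-nondegenerate idempotent solution of the Yang--Baxter equation; $x_i\mapsto v_i:=x_1^{d-1}x_i$ is a bijection $X\to\mathcal N_d$; and the map $r^{(d)}$ on $X\times X$ corresponding to $\rho_d$ under $x_i\leftrightarrow v_i$ is a left-nondegenerate idempotent solution of the Yang--Baxter equation. (b) There are indices $p_{ij}\in\{1,\dots,n\}$ with $\mathrm{Nor}(v_iv_j)=v_1v_{p_{ij}}$ for all $i,j$, and with the relations $$\Re=\{x_ix_j-x_1x_{p_{ij}}\mid 2\le i\le n,\ 1\le j\le n\}\subset\mathbf{k}\langle X\rangle$$ both graded algebras are PBW algebras with the same quadratic presentation: $\Re$ is a Gröbner basis, with respect to the degree-lexicographic order, of the kernel of the surjective graded homomorphism $\mathbf{k}\langle X\rangle\to\mathcal A(\mathbf{k},X,r^{(d)})$, $x_i\mapsto x_i$, and also of the kernel of the surjective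 graded homomorphism $\mathbf{k}\langle X\rangle\to\mathcal A^{(d)}$, $x_i\mapsto v_i$. In particular $x_1,\dots,x_n$ and $v_1,\dots,v_n$ are PBW generators of the respective algebras. (c) There is an isomorphism of graded $\mathbf{k}$-algebras $\mathcal A(\mathbf{k},X,r^{(d)})\to\mathcal A^{(d)}$ with $x_i\mapsto v_i$ for all $i$. (d) There is a $\mathbf{k}$-algebra homomorphism (the $d$-Veronese morphism) $\nu_d:\mathcal A(\mathbf{k},\mathcal N_d,\rho_d)\to\mathcal A(\mathbf{k},X,r)$ that sends each generator $w\in\mathcal N_d$ to the element of $\mathcal A$ represented by the word $w$; it is injective, with image $\mathcal A^{(d)}$. -/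

import Mathlib

namespace YangBaxter

/-! ### Set-theoretic solutions of the Yang-Baxter equation -/

section Solutions

variable {X : Type*}

/-- The map `r × id` on `X × X × X`. -/
def braid12 (r : X × X → X × X) (t : X × X × X) : X × X × X :=
  ((r (t.1, t.2.1)).1, (r (t.1, t.2.1)).2, t.2.2)

/-- The map `id × r` on `X × X × X`. -/
def braid23 (r : X × X → X × X) (t : X × X × X) : X × X × X :=
  (t.1, r (t.2.1, t.2.2))

/-- `(X, r)` is a braided set: `r` satisfies the braid relation. No bijectivity is assumed. -/
def IsBraided (r : X × X → X × X) : Prop :=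
  braid12 r ∘ braid23 r ∘ braid12 r = braid23 r ∘ braid12 r ∘ braid23 r

/-- Writing `r (x, y) = (ˣy, xʸ)`, every left action `y ↦ ˣy` is a bijection. -/
def IsLeftNondegenerate (r : X × X → X × X) : Prop :=
  ∀ x : X, Function.Bijective fun y : X => (r (x, y)).1

/-- A left-nondegenerate idempotent set-theoretic solution of the Yang-Baxter equation. -/
structure IsLNDIdempotentSolution (r : X × X → X × X) : Prop where
  braided : IsBraided r
  leftNondegenerate : IsLeftNondegenerate r
  idempotent : r ∘ r = r

/-- Transport of a map `X × X → X × X` along a bijection `Y ≃ X`. -/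
def transport {Y : Type*} (e : Y ≃ X) (r : X × X → X × X) (p : Y × Y) : Y × Y :=
  (e.symm (r (e p.1, e p.2)).1, e.symm (r (e p.1, e p.2)).2)

/-- The left action `ᶜb` of a letter `c` on a word `b`, defined by
`ᶜ(b₁ b₂ ⋯ b_q) = (ᶜb₁) ᶜ'(b₂ ⋯ b_q)` with `c' = c ^ b₁`. -/
def letterActWord (r : X × X → X × X) : X → List X → List X
  | _, [] => []
  | c, b :: bs => (r (c, b)).1 :: letterActWord r (r (c, b)).2 bs

/-- The right action `cᵇ` of a word `b` on a letter `c`, defined by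
`c ^ (b₁ b₂ ⋯ b_q) = (c ^ b₁) ^ (b₂ ⋯ b_q)`. -/
def letterActedByWord (r : X × X → X × X) : X → List X → X
  | c, [] => c
  | c, b :: bs => letterActedByWord r (r (c, b)).2 bs

/-- The left action `ᵃb` of a word `a` on a word `b`, defined by
`⁽ᵃ¹ ᵃ² ⋯ ᵃᵖ⁾b = ᵃ¹(⁽ᵃ² ⋯ ᵃᵖ⁾b)`. -/
def leftAct (r : X × X → X × X) : List X → List X → List X
  | [], b => b
  | a :: as, b => letterActWord r a (leftAct r as b)

/-- The right action `aᵇ` of a word `b` on a word `a`, defined by the matched pair rule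
`(a₁ u) ^ b = (a₁ ^ (ᵘb)) (u ^ b)`. -/
def rightAct (r : X × X → X × X) : List X → List X → List X
  | [], _ => []
  | a :: as, b => letterActedByWord r a (leftAct r as b) :: rightAct r as b

theorem length_letterActWord (r : X × X → X × X) (c : X) (b : List X) :
    (letterActWord r c b).length = b.length := by
  induction b generalizing c with
  | nil => rfl
  | cons b bs ih => simp [letterActWord, ih]

theorem length_leftAct (r : X × X → X × X) (a b : List X) :
    (leftAct r a b).length = b.length := by
  induction a with
  | nil => rfl
  | cons a as ih => simp [leftAct, length_letterActWord, ih]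

theorem length_rightAct (r : X × X → X × X) (a b : List X) :
    (rightAct r a b).length = a.length := by
  induction a with
  | nil => rfl
  | cons a as ih => simp [rightAct, ih]

end Solutions

/-! ### The free associative algebra, deg-lex order, Gröbner bases -/

section Free

/-- The free associative algebra `k⟨X⟩`, with basis the words in the alphabet `X`. -/
abbrev FreeAlg (k X : Type*) [Field k] : Type _ := MonoidAlgebra k (FreeMonoid X)

/-- A word, as a monomial in `k⟨X⟩`. -/
noncomputable abbrev mono (k : Type*) {X : Type*} [Field k] (w : FreeMonoid X) : FreeAlg k X :=
  MonoidAlgebra.of k (FreeMonoid X) w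

/-- The homogeneous component of degree `m` of `k⟨X⟩`. -/
noncomputable def wordSpan (k X : Type*) [Field k] (m : ℕ) : Submodule k (FreeAlg k X) :=
  Submodule.span k {f | ∃ w : FreeMonoid X, w.length = m ∧ f = mono k w}

/-- The degree-lexicographic order on words. -/
def DegLex {X : Type*} [LinearOrder X] (u v : FreeMonoid X) : Prop :=
  List.Shortlex (· < ·) u.toList v.toList

/-- `u` is the leading monomial of `f` (in particular `f ≠ 0`). -/
def IsLeadingMonomial {k X : Type*} [Field k] [LinearOrder X]
    (f : FreeAlg k X) (u : FreeMonoid X) : Prop :=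
  u ∈ f.coeff.support ∧ ∀ v ∈ f.coeff.support, v ≠ u → DegLex v u

/-- The word `w` is normal modulo `F`: no leading monomial of an element of `F` is a subword
of `w`. -/
def IsNormalMod {k X : Type*} [Field k] [LinearOrder X]
    (F : Set (FreeAlg k X)) (w : FreeMonoid X) : Prop :=
  ∀ f ∈ F, ∀ u, IsLeadingMonomial f u → ∀ a b : FreeMonoid X, w ≠ a * u * b

/-- `G` is a Gröbner basis, consisting of monic polynomials, of the two-sided ideal `I` with
respect to the deg-lex order. -/
structure IsGroebnerBasis {k X : Type*} [Field k] [LinearOrder X]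
    (G : Set (FreeAlg k X)) (I : TwoSidedIdeal (FreeAlg k X)) : Prop where
  monic : ∀ g ∈ G, ∃ u, IsLeadingMonomial g u ∧ g.coeff u = 1
  span_eq : TwoSidedIdeal.span G = I
  divides : ∀ f ∈ I, ∀ u, IsLeadingMonomial f u →
    ∃ g ∈ G, ∃ w, IsLeadingMonomial g w ∧ ∃ a b : FreeMonoid X, u = a * w * b

/-- The algebra map `k⟨X⟩ → A` determined by the images `g x` of the letters. -/
noncomputable def evalAt {k X A : Type*} [Field k] [Ring A] [Algebra k A] (g : X → A) :
    FreeAlg k X →ₐ[k] A :=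
  MonoidAlgebra.lift k A (FreeMonoid X) (FreeMonoid.lift g)

/-- The graded algebra `A = ⨁ 𝒜 m` is a PBW algebra with PBW generators `g x`, enumerated in the
order of `X`, and with standard finite presentation `A = k⟨X⟩ / (R)`: it is the graded
quotient of `k⟨X⟩` by the relations `R`, and `R` is a finite Gröbner basis consisting of
homogeneous quadratic polynomials. -/
structure IsPBWPresentation {k X A : Type*} [Field k] [LinearOrder X] [Ring A] [Algebra k A]
    (𝒜 : ℕ → Submodule k A) (g : X → A) (R : Set (FreeAlg k X)) : Prop where
  surjective : Function.Surjective (evalAt (k := k) g)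
  graded : ∀ m, (wordSpan k X m).map (evalAt (k := k) g).toLinearMap = 𝒜 m
  finite : R.Finite
  quadratic : ∀ f ∈ R, f ∈ wordSpan k X 2
  groebner : IsGroebnerBasis R (TwoSidedIdeal.ker (evalAt (k := k) g))

end Free

/-! ### Yang-Baxter algebras -/

section Algebra

variable (k : Type*) [Field k] {X : Type*}

/-- The defining relations `xy - y'x'`, where `r (x, y) = (y', x') ≠ (x, y)`. -/
def ybRelations (r : X × X → X × X) : Set (FreeAlg k X) :=
  {f | ∃ x y : X, r (x, y) ≠ (x, y) ∧
    f = mono k (FreeMonoid.of x * FreeMonoid.of y) -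
      mono k (FreeMonoid.of (r (x, y)).1 * FreeMonoid.of (r (x, y)).2)}

/-- The two-sided ideal of `k⟨X⟩` generated by the defining relations. -/
noncomputable def ybIdeal (r : X × X → X × X) : TwoSidedIdeal (FreeAlg k X) :=
  TwoSidedIdeal.span (ybRelations k r)

/-- The Yang-Baxter algebra `𝒜(k, X, r)`. -/
abbrev YBAlgebra (r : X × X → X × X) : Type _ := (ybIdeal k r).ringCon.Quotient

/-- The quotient map `k⟨X⟩ → 𝒜(k, X, r)`. -/
noncomputable def ybMk (r : X × X → X × X) : FreeAlg k X →ₐ[k] YBAlgebra k r :=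
  (ybIdeal k r).ringCon.mkₐ k

/-- The element of `𝒜(k, X, r)` represented by a word. -/
noncomputable def ybWord (r : X × X → X × X) (w : FreeMonoid X) : YBAlgebra k r :=
  ybMk k r (mono k w)

/-- The canonical generators of `𝒜(k, X, r)`. -/
noncomputable def ybGen (r : X × X → X × X) (x : X) : YBAlgebra k r :=
  ybWord k r (FreeMonoid.of x)

/-- The grading of `𝒜(k, X, r)` by length. -/
noncomputable def ybGrading (r : X × X → X × X) (m : ℕ) : Submodule k (YBAlgebra k r) :=
  (wordSpan k X m).map (ybMk k r).toLinearMap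

theorem mono_mem_wordSpan (w : FreeMonoid X) : mono k w ∈ wordSpan k X w.length :=
  Submodule.subset_span ⟨w, rfl, rfl⟩

theorem wordSpan_mul {m n : ℕ} {f g : FreeAlg k X} (hf : f ∈ wordSpan k X m)
    (hg : g ∈ wordSpan k X n) : f * g ∈ wordSpan k X (m + n) := by
  have h := Submodule.mul_mem_mul hf hg
  rw [wordSpan, wordSpan, Submodule.span_mul_span] at h
  refine Submodule.span_mono ?_ h
  rintro _ ⟨_, ⟨u, hu, rfl⟩, _, ⟨v, hv, rfl⟩, rfl⟩
  exact ⟨u * v, by rw [FreeMonoid.length_mul, hu, hv], (map_mul _ _ _).symm⟩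

instance ybGrading_gradedMonoid (r : X × X → X × X) : SetLike.GradedMonoid (ybGrading k r) where
  one_mem := ⟨mono k 1, mono_mem_wordSpan k 1,
    (congrArg (ybMk k r) (map_one (MonoidAlgebra.of k (FreeMonoid X)))).trans
      (map_one (ybMk k r))⟩
  mul_mem := by
    rintro m n _ _ ⟨f, hf, rfl⟩ ⟨g, hg, rfl⟩
    exact ⟨f * g, wordSpan_mul k hf hg, map_mul (ybMk k r) f g⟩

theorem ybWord_mem (r : X × X → X × X) (w : FreeMonoid X) :
    ybWord k r w ∈ ybGrading k r w.length :=
  ⟨mono k w, mono_mem_wordSpan k w, rfl⟩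

end Algebra

/-! ### Veronese subalgebras -/

section Veronese

variable {k A : Type*} [Field k] [Ring A] [Algebra k A]

/-- The `d`-Veronese subalgebra `⨁ₘ A_{md}` of a graded algebra `A = ⨁ₘ A_m`. -/
def veronese (𝒜 : ℕ → Submodule k A) [SetLike.GradedMonoid 𝒜] (d : ℕ) : Subalgebra k A :=
  (⨆ m, 𝒜 (m * d)).toSubalgebra
    (Submodule.mem_iSup_of_mem 0 (by rw [zero_mul]; exact SetLike.GradedOne.one_mem))
    (by
      intro x y hx hy
      have h := Submodule.mul_mem_mul hx hy
      rw [Submodule.iSup_mul] at h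
      refine (iSup_le fun m => ?_ : _ ≤ ⨆ m, 𝒜 (m * d)) h
      rw [Submodule.mul_iSup]
      refine iSup_le fun n => Submodule.mul_le.2 fun a ha b hb => ?_
      refine Submodule.mem_iSup_of_mem (m + n) ?_
      rw [add_mul]
      exact SetLike.GradedMul.mul_mem ha hb)

/-- The grading of the `d`-Veronese subalgebra, whose component of degree `m` is `A_{md}`. -/
def veroneseGrading (𝒜 : ℕ → Submodule k A) [SetLike.GradedMonoid 𝒜] (d m : ℕ) :
    Submodule k (veronese 𝒜 d) :=
  (𝒜 (m * d)).comap (veronese 𝒜 d).val.toLinearMap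

theorem mem_veronese (𝒜 : ℕ → Submodule k A) [SetLike.GradedMonoid 𝒜] {d : ℕ} {a : A}
    (ha : a ∈ 𝒜 d) : a ∈ veronese 𝒜 d :=
  Submodule.mem_iSup_of_mem (p := fun m => 𝒜 (m * d)) 1 (by rwa [one_mul])

end Veronese

/-! ### Normal words and normal forms -/

section Normal

variable (k : Type*) [Field k] {X : Type*}

theorem ybIdeal_length {r : X × X → X × X} {u w : FreeMonoid X}
    (h : mono k u - mono k w ∈ ybIdeal k r) : u.length = w.length := by
  let D : FreeAlg k X →ₐ[k] MonoidAlgebra k (Multiplicative ℕ) :=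
    MonoidAlgebra.mapDomainAlgHom k k (FreeMonoid.lift fun _ : X => Multiplicative.ofAdd 1)
  have hw : ∀ w : FreeMonoid X, (FreeMonoid.lift fun _ : X => Multiplicative.ofAdd 1) w =
      Multiplicative.ofAdd w.length := by
    intro w
    induction w using FreeMonoid.inductionOn' with
    | one => rfl
    | of_mul x w ih => rw [map_mul, ih, FreeMonoid.length_mul]; rfl
  have hD : ∀ w : FreeMonoid X, D (mono k w) =
      MonoidAlgebra.single (Multiplicative.ofAdd w.length) 1 := by
    intro w
    simp [D, mono, hw]
  have hle : ybIdeal k r ≤ TwoSidedIdeal.ker D := by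
    refine TwoSidedIdeal.span_le.2 ?_
    rintro _ ⟨x, y, -, rfl⟩
    rw [SetLike.mem_coe, TwoSidedIdeal.mem_ker, map_sub, hD, hD]
    simp [FreeMonoid.length_mul]
  have h0 := (TwoSidedIdeal.mem_ker _).1 (hle h)
  rw [map_sub, hD, hD, sub_eq_zero] at h0
  have h1 := MonoidAlgebra.single_left_injective (one_ne_zero (α := k)) h0
  simpa using h1

/-- Congruence of words modulo the ideal of relations. -/
def wordCon (r : X × X → X × X) : Con (FreeMonoid X) where
  r u w := mono k u - mono k w ∈ ybIdeal k r
  iseqv :=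
    { refl := fun u => by rw [sub_self]; exact zero_mem _
      symm := fun {u w} h => by rw [← neg_sub]; exact neg_mem h
      trans := fun {u v w} h h' => by
        rw [← sub_add_sub_cancel _ (mono k v)]; exact add_mem h h' }
  mul' := fun {u u' w w'} h h' => by
    have : mono k (u * w) - mono k (u' * w') =
        (mono k u - mono k u') * mono k w + mono k u' * (mono k w - mono k w') := by
      simp only [mono, map_mul]; noncomm_ring
    rw [this]
    exact add_mem (TwoSidedIdeal.mul_mem_right _ _ _ h) (TwoSidedIdeal.mul_mem_left _ _ _ h')

variable [LinearOrder X]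

theorem exists_smaller {r : X × X → X × X} {f : FreeAlg k X} (hf : f ∈ ybIdeal k r)
    {u : FreeMonoid X} (hu : IsLeadingMonomial f u) :
    ∃ v, DegLex v u ∧ mono k v - mono k u ∈ ybIdeal k r := by
  classical
  let P : FreeAlg k X →ₐ[k] MonoidAlgebra k (wordCon k r).Quotient :=
    MonoidAlgebra.mapDomainAlgHom k k (wordCon k r).mk'
  have hP : ∀ w : FreeMonoid X, P (mono k w) = MonoidAlgebra.single ((wordCon k r).mk' w) 1 := by
    intro w
    simp [P, mono]
  have hle : ybIdeal k r ≤ TwoSidedIdeal.ker P := by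
    refine TwoSidedIdeal.span_le.2 ?_
    rintro _ ⟨x, y, hxy, rfl⟩
    rw [SetLike.mem_coe, TwoSidedIdeal.mem_ker, map_sub, hP, hP, sub_eq_zero]
    congr 1
    exact (Con.eq _).2 (TwoSidedIdeal.subset_span ⟨x, y, hxy, rfl⟩)
  have h0 : P f = 0 := (TwoSidedIdeal.mem_ker _).1 (hle hf)
  by_contra! hcon
  have h1 : (P f).coeff ((wordCon k r).mk' u) = f.coeff u := by
    have : (P f).coeff = Finsupp.mapDomain (wordCon k r).mk' f.coeff := rfl
    rw [this, Finsupp.mapDomain, Finsupp.sum_apply, Finsupp.sum,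
      Finset.sum_eq_single_of_mem u hu.1]
    · simp
    · intro v hv hvu
      rw [Finsupp.single_apply, if_neg]
      intro he
      exact hcon v (hu.2 v hv hvu) ((Con.eq _).1 he)
  rw [h0] at h1
  exact (Finsupp.mem_support_iff.1 hu.1) h1.symm

theorem degLex_wellFounded [Finite X] : WellFounded (DegLex (X := X)) :=
  InvImage.wf FreeMonoid.toList (List.Shortlex.wf wellFounded_lt)

theorem degLex_mul {a u v b : FreeMonoid X} (hl : v.length = u.length) (h : DegLex v u) :
    DegLex (a * v * b) (a * u * b) := by
  have key : ∀ s t c : List X, s.length = t.length → List.Lex (· < ·) s t →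
      List.Lex (· < ·) (s ++ c) (t ++ c) := by
    intro s t c hst hlex
    induction hlex with
    | nil => simp at hst
    | cons _ ih => exact List.Lex.cons (ih (by simpa using hst))
    | rel h => exact List.Lex.rel h
  have h' : List.Shortlex (· < ·) (v.toList ++ b.toList) (u.toList ++ b.toList) :=
    List.Shortlex.of_lex (by
      have : v.toList.length = u.toList.length := hl
      simp [this]) (key _ _ _ hl ((List.shortlex_iff_lex hl).1 h))
  have h2 := List.Shortlex.append_left h' a.toList
  rw [mul_assoc, mul_assoc]
  exact h2

/-- Every word has a unique normal form modulo the ideal of relations. -/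
theorem existsUnique_normalForm [Finite X] (r : X × X → X × X) (w : FreeMonoid X) :
    ∃! u : FreeMonoid X, IsNormalMod (ybIdeal k r : Set (FreeAlg k X)) u ∧
      mono k w - mono k u ∈ ybIdeal k r := by
  classical
  obtain ⟨u, hu, hmin⟩ := (degLex_wellFounded (X := X)).has_min
    {u | mono k w - mono k u ∈ ybIdeal k r} ⟨w, (wordCon k r).refl w⟩
  refine ⟨u, ⟨?_, hu⟩, ?_⟩
  · rintro f hf m hm a b rfl
    obtain ⟨v, hvm, hv⟩ := exists_smaller k hf hm
    refine hmin (a * v * b) ?_ (degLex_mul (ybIdeal_length k hv) hvm)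
    refine (wordCon k r).trans hu ((wordCon k r).symm ?_)
    exact (wordCon k r).mul ((wordCon k r).mul ((wordCon k r).refl a) hv) ((wordCon k r).refl b)
  · rintro u' ⟨hn', hu'⟩
    by_contra hne
    have key : ∀ s t : FreeMonoid X, s ≠ t → DegLex s t →
        IsLeadingMonomial (mono k t - mono k s) t := by
      intro s t hst hlt
      have hc : (mono k t - mono k s).coeff = Finsupp.single t (1 : k) - Finsupp.single s 1 := rfl
      refine ⟨?_, ?_⟩
      · rw [hc]; simp [hst]
      · intro v hv hvt
        rw [hc] at hv
        by_cases hvs : v = s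
        · exact hvs ▸ hlt
        · simp [Ne.symm hvt, Ne.symm hvs] at hv
    have hlt : DegLex u u' := by
      rcases Std.Trichotomous.rel_or_eq_or_rel_swap (r := List.Shortlex (· < ·))
        (a := u.toList) (b := u'.toList) with h | h | h
      · exact h
      · exact (hne h.symm).elim
      · exact (hmin u' hu' h).elim
    have hI : mono k u' - mono k u ∈ ybIdeal k r :=
      (wordCon k r).trans ((wordCon k r).symm hu') hu
    exact hn' _ hI u' (key u u' (Ne.symm hne) hlt) 1 1 (by simp)

/-- The normal form `Nor(w)` of a word `w`: the unique normal word that is congruent to `w`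
modulo the ideal of relations. -/
noncomputable def nor [Finite X] (r : X × X → X × X) (w : FreeMonoid X) : FreeMonoid X :=
  (existsUnique_normalForm k r w).choose

theorem nor_normal [Finite X] (r : X × X → X × X) (w : FreeMonoid X) :
    IsNormalMod (ybIdeal k r : Set (FreeAlg k X)) (nor k r w) :=
  (existsUnique_normalForm k r w).choose_spec.1.1

theorem length_nor [Finite X] (r : X × X → X × X) (w : FreeMonoid X) :
    (nor k r w).length = w.length :=
  (ybIdeal_length k (existsUnique_normalForm k r w).choose_spec.1.2).symm

/-- The set `𝒩_d` of normal words of length `d`. -/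
def NormalWord (r : X × X → X × X) (d : ℕ) : Type _ :=
  {w : FreeMonoid X // IsNormalMod (ybIdeal k r : Set (FreeAlg k X)) w ∧ w.length = d}

/-- The `d`-Veronese solution `ρ_d (a, b) = (Nor(ᵃb), Nor(aᵇ))` on the set `𝒩_d`. -/
noncomputable def veroneseSolution [Finite X] (r : X × X → X × X) (d : ℕ)
    (p : NormalWord k r d × NormalWord k r d) : NormalWord k r d × NormalWord k r d :=
  (⟨nor k r (FreeMonoid.ofList (leftAct r p.1.1.toList p.2.1.toList)), nor_normal k r _,
      (length_nor k r _).trans ((length_leftAct r _ _).trans p.2.2.2)⟩,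
    ⟨nor k r (FreeMonoid.ofList (rightAct r p.1.1.toList p.2.1.toList)), nor_normal k r _,
      (length_nor k r _).trans ((length_rightAct r _ _).trans p.1.2.2)⟩)

/-- The solution `r^{(d)}` on `X` that corresponds to the `d`-Veronese solution `(𝒩_d, ρ_d)`
under an identification `v` of `X` with `𝒩_d`. -/
noncomputable def veroneseProlongation [Finite X] (r : X × X → X × X) (d : ℕ)
    (v : X ≃ NormalWord k r d) : X × X → X × X :=
  transport v (veroneseSolution k r d)

/-- A normal word of length `d`, as an element of the `d`-Veronese subalgebra. -/
noncomputable def veroneseGen (r : X × X → X × X) (d : ℕ) (w : NormalWord k r d) :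
    veronese (ybGrading k r) d :=
  ⟨ybWord k r w.1, mem_veronese _ (by simpa only [w.2.2] using ybWord_mem k r w.1)⟩

end Normal

/-- The quadratic relations `xᵢxⱼ - x₁x_{p(i,j)}`, one for each pair `(i, j)` with `xᵢ ≠ x₁`. -/
def standardRelations (k : Type*) [Field k] {X : Type*} (x₁ : X) (p : X → X → X) :
    Set (FreeAlg k X) :=
  {f | ∃ x y : X, x ≠ x₁ ∧ f = mono k (FreeMonoid.of x * FreeMonoid.of y) -
    mono k (FreeMonoid.of x₁ * FreeMonoid.of (p x y))}

end YangBaxter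

namespace YangBaxter

/-! ### The structure of left-nondegenerate idempotent solutions -/

section Structure

variable {X : Type*}

/-! Idempotency makes r rigid. If z = ˣy, then r fixes (z, xʸ), so ᶻ(xʸ) = z, and left nondegeneracy
determines xʸ from z: r (x, y) = (z, q z) for a single map q. The braid relation adds q (q (ˣt)) = q
t. Conversely, these identities reduce the braid relation to its first coordinate
(`IsDiagonalMap.isLNDIdempotentSolution`).

Define the value of a word x₁⋯x_m as x₁ applied to (x₂ applied to (⋯ x_m)). Defining relations
preserve values. Conversely, any prescribed letter can be moved to the front of a word of length at
least 2 and then cancelled, as letters act injectively. So two words are congruent exactly when they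
have the same length and the same value (`wordCon_iff`). Each component of positive degree therefore
has dimension n, and with x₁ the least letter the normal words of length m ≥ 1 are x₁^(m-1) x. This
yields the Gröbner basis: a word is empty, of that form, or contains some xy with x ≠ x₁.

Taking values identifies 𝒩_d with X. Under this identification ρ_d has as left action the action of
words of length d on X, and as diagonal map the iterate q^[d]; hence ρ_d is again a solution of the
same kind. Moreover a word in the alphabet 𝒩_d and its concatenation in X have matching values, so
concatenation preserves and reflects congruence (`wordCon_flatten_iff`). Since the Yang-Baxter
algebra is the monoid algebra of words modulo congruence, the Veronese morphism is injective; its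
image is the Veronese subalgebra because a word of length md splits into m blocks of length d. The
PBW presentation, proved for any solution of this kind, applies to r^(d) and is carried over by the
isomorphism. -/

/-- A map `q` such that `r (x, y) = (z, q z)` with `z = ˣy`, subject to the identities that
`q` satisfies in a left-nondegenerate idempotent solution. -/
structure IsDiagonalMap (r : X × X → X × X) (q : X → X) : Prop where
  snd_eq : ∀ x y, (r (x, y)).2 = q (r (x, y)).1
  fst_diag : ∀ x, (r (x, q x)).1 = x
  diag_diag : ∀ x t, q (q (r (x, t)).1) = q t

theorem IsLNDIdempotentSolution.fst_fst {r : X × X → X × X} (hr : IsLNDIdempotentSolution r)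
    (x y w : X) :
    (r (x, (r (y, w)).1)).1 = (r ((r (x, y)).1, (r ((r (x, y)).2, w)).1)).1 :=
  (congrArg Prod.fst (congrFun hr.braided (x, y, w))).symm

/-- `q x` is the solution y of ˣy = x. Idempotency says that the second component of `r (x, y)`
solves this equation for the first, and the solution is unique. -/
theorem IsLNDIdempotentSolution.exists_isDiagonalMap {r : X × X → X × X}
    (hr : IsLNDIdempotentSolution r) : ∃ q, IsDiagonalMap r q := by
  choose q hq using fun x => (hr.leftNondegenerate x).2 x
  dsimp only at hq
  have hsnd : ∀ x y, (r (x, y)).2 = q (r (x, y)).1 := fun x y =>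
    (hr.leftNondegenerate (r (x, y)).1).1
      ((congrArg Prod.fst (congrFun hr.idempotent (x, y))).trans (hq _).symm)
  refine ⟨q, hsnd, hq, fun x t => ?_⟩
  obtain ⟨w, rfl⟩ := (hr.leftNondegenerate x).2 t
  dsimp only
  -- With t = ˣw and A = ˣt, the middle coordinate of the braid relation says that q A acting on q t
  -- gives q A. By definition of q, acting on q (q A) gives the same, so the two arguments agree.
  have h := congrArg (fun t => t.2.1) (congrFun hr.braided (x, x, w))
  simp only [braid12, braid23, Function.comp_apply] at h
  rw [hsnd, ← hr.fst_fst, hsnd x, hsnd x w] at h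
  exact (hr.leftNondegenerate _).1 ((hq _).trans h)

/-- Second components are functions of first ones, so once the first coordinates of the braid
relation agree, `diag_diag` and `fst_diag` force the other two. -/
theorem IsDiagonalMap.isLNDIdempotentSolution {r : X × X → X × X} {q : X → X}
    (hq : IsDiagonalMap r q) (hl : IsLeftNondegenerate r)
    (hb : ∀ x y w, (r (x, (r (y, w)).1)).1 = (r ((r (x, y)).1, (r ((r (x, y)).2, w)).1)).1) :
    IsLNDIdempotentSolution r where
  leftNondegenerate := hl
  idempotent := by
    have h : ∀ p, r p = ((r p).1, q (r p).1) := fun p => Prod.ext rfl (hq.snd_eq p.1 p.2)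
    funext p
    have h1 : (r (r p)).1 = (r p).1 := by
      rw [h p]; exact hq.fst_diag _
    exact Prod.ext h1 (by rw [Function.comp_apply, hq.snd_eq, h1, ← hq.snd_eq])
  braided := by
    funext ⟨x, y, w⟩
    have hd : ∀ u t, q (q u) = q t → (r (q u, q t)).1 = q u := fun u t h => by
      rw [← h]; exact hq.fst_diag _
    have h := hb x y w
    simp only [braid12, braid23, Function.comp_apply, Prod.ext_iff]
    refine ⟨h.symm, ?_, ?_⟩
    · rw [hq.snd_eq, ← h, hq.snd_eq x, hq.snd_eq y, hd _ _ (hq.diag_diag _ _)]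
    · rw [hq.snd_eq _ (r (y, w)).2, hq.snd_eq x (r (y, w)).1, hq.snd_eq y w,
        hd _ _ (hq.diag_diag _ _), h, hq.snd_eq _ w]
      exact (hq.diag_diag _ _).symm

theorem IsLNDIdempotentSolution.transport {Y : Type*} {r : X × X → X × X}
    (hr : IsLNDIdempotentSolution r) (e : Y ≃ X) :
    IsLNDIdempotentSolution (transport e r) where
  braided := by
    funext ⟨x, y, w⟩
    have h := congrFun hr.braided (e x, e y, e w)
    simp only [braid12, braid23, Function.comp_apply, Prod.ext_iff] at h
    simp only [braid12, braid23, Function.comp_apply, YangBaxter.transport,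
      Equiv.apply_symm_apply, Prod.ext_iff, EmbeddingLike.apply_eq_iff_eq]
    exact h
  leftNondegenerate x :=
    e.symm.bijective.comp ((hr.leftNondegenerate (e x)).comp e.bijective)
  idempotent := by
    funext p
    simp only [Function.comp_apply, YangBaxter.transport, Equiv.apply_symm_apply, Prod.mk.eta]
    have h := congrFun hr.idempotent (e p.1, e p.2)
    rw [Function.comp_apply] at h
    rw [h]

end Structure

/-! ### The action of words on `Option X` -/

section WordAct

variable {X : Type*}

/-- The action of words on `Option X` in which a letter `x` sends `none` to `x` and a letter `y`
to `ˣy`. The image of `none` under a nonempty word `x₁ ⋯ x_m` is the value of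
`x₁`, ..., `x_{m-1}` acting on `x_m`. -/
def wordAct (r : X × X → X × X) : FreeMonoid X →* Function.End (Option X) :=
  FreeMonoid.lift fun x o => some (o.elim x fun y => (r (x, y)).1)

variable {r : X × X → X × X}

theorem wordAct_one (o : Option X) : wordAct r 1 o = o := by rw [map_one]; rfl

theorem wordAct_mul (u w : FreeMonoid X) (o : Option X) :
    wordAct r (u * w) o = wordAct r u (wordAct r w o) := by rw [map_mul]; rfl

theorem wordAct_of_none (x : X) : wordAct r (.of x) none = some x :=
  congrFun (FreeMonoid.lift_eval_of (M := Function.End (Option X)) _ x) none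

theorem wordAct_of_some (x y : X) : wordAct r (.of x) (some y) = some (r (x, y)).1 :=
  congrFun (FreeMonoid.lift_eval_of (M := Function.End (Option X)) _ x) (some y)

theorem exists_wordAct_some (w : FreeMonoid X) (t : X) : ∃ s, wordAct r w (some t) = some s := by
  induction w using FreeMonoid.inductionOn' with
  | one => exact ⟨t, wordAct_one _⟩
  | of_mul x w ih =>
    obtain ⟨s, hs⟩ := ih
    exact ⟨_, by rw [wordAct_mul, hs, wordAct_of_some]⟩

theorem exists_wordAct_none {w : FreeMonoid X} (hw : w.length ≠ 0) :
    ∃ s, wordAct r w none = some s := by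
  induction w using FreeMonoid.inductionOn' with
  | one => exact (hw rfl).elim
  | of_mul x w ih =>
    by_cases h : w.length = 0
    · rw [FreeMonoid.length_eq_zero.1 h]
      exact ⟨x, by rw [wordAct_mul, wordAct_one, wordAct_of_none]⟩
    · obtain ⟨s, hs⟩ := ih h
      exact ⟨_, by rw [wordAct_mul, hs, wordAct_of_some]⟩

theorem wordAct_some_injective (hl : IsLeftNondegenerate r) (w : FreeMonoid X) {s t : X}
    (h : wordAct r w (some s) = wordAct r w (some t)) : s = t := by
  induction w using FreeMonoid.inductionOn' generalizing s t with
  | one => simpa [wordAct_one] using h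
  | of_mul x w ih =>
    obtain ⟨s', hs⟩ := exists_wordAct_some (r := r) w s
    obtain ⟨t', ht⟩ := exists_wordAct_some (r := r) w t
    rw [wordAct_mul, wordAct_mul, hs, ht, wordAct_of_some, wordAct_of_some, Option.some_inj] at h
    exact ih (by rw [hs, ht, (hl x).1 h])

/-- On `none` this is idempotency; on letters it is the first coordinate of the braid relation. -/
theorem wordAct_of_mul_of (hr : IsLNDIdempotentSolution r) (x y : X) :
    wordAct r (.of x * .of y) = wordAct r (.of (r (x, y)).1 * .of (r (x, y)).2) := by
  funext o
  cases o with
  | none =>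
    simp only [wordAct_mul, wordAct_of_none, wordAct_of_some]
    exact congrArg (fun p => some p.1) (congrFun hr.idempotent (x, y)).symm
  | some w =>
    simp only [wordAct_mul, wordAct_of_some]
    rw [hr.fst_fst]

/-- Each letter of `w` is absorbed by one application of q through q (q (ˣt)) = q t. That identity
leaves one q in place, hence `j ≠ 0`. -/
theorem IsDiagonalMap.iterate_eq {q : X → X} (hq : IsDiagonalMap r q) (w : FreeMonoid X)
    {j : ℕ} (hj : j ≠ 0) {s t : X} (h : wordAct r w (some s) = some t) :
    q^[j + w.length] t = q^[j] s := by
  induction w using FreeMonoid.inductionOn' generalizing t with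
  | one =>
    rw [wordAct_one, Option.some_inj] at h
    rw [h]; rfl
  | of_mul x w ih =>
    obtain ⟨t', ht⟩ := exists_wordAct_some (r := r) w s
    rw [wordAct_mul, ht, wordAct_of_some, Option.some_inj] at h
    obtain ⟨i, rfl⟩ := Nat.exists_eq_succ_of_ne_zero hj
    rw [← ih ht, ← h, FreeMonoid.length_mul, FreeMonoid.length_of,
      show i.succ + (1 + w.length) = i + w.length + 2 by omega,
      show i.succ + w.length = i + w.length + 1 by omega, Function.iterate_add_apply,
      Function.iterate_succ_apply q (i + w.length), ← hq.diag_diag x t']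
    rfl

/-- The analogue of `fst_diag` for words: it makes q^[d] the diagonal map for the action of words of
length d. -/
theorem IsDiagonalMap.wordAct_iterate {q : X → X} (hq : IsDiagonalMap r q) (w : FreeMonoid X)
    {t : X} (h : wordAct r w none = some t) : wordAct r w (some (q^[w.length] t)) = some t := by
  induction w using FreeMonoid.inductionOn' generalizing t with
  | one => simp [wordAct_one] at h
  | of_mul x w ih =>
    by_cases hw : w.length = 0
    · rw [FreeMonoid.length_eq_zero.1 hw, mul_one] at h ⊢
      rw [wordAct_of_none, Option.some_inj] at h
      rw [h, wordAct_of_some, FreeMonoid.length_of, Function.iterate_one, hq.fst_diag]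
    · obtain ⟨t', ht⟩ := exists_wordAct_none (r := r) hw
      rw [wordAct_mul, ht] at h
      -- Taking j to be the length of `w` turns the iterate at t into the iterate at t', the value
      -- of `w`, to which the induction hypothesis applies.
      have := hq.iterate_eq (.of x) hw h
      rw [FreeMonoid.length_mul, add_comm, FreeMonoid.length_of, ← FreeMonoid.length_of x, this,
        wordAct_mul, ih ht, h]

/-- The letter c moves through b by successive applications of r, none of which changes the value.
For empty b the right side would be the value c instead of `none`. -/
theorem wordAct_letterActWord_none (hr : IsLNDIdempotentSolution r) (c : X) {b : List X}
    (hb : b ≠ []) : wordAct r (.ofList (letterActWord r c b)) none =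
      wordAct r (.of c) (wordAct r (.ofList b) none) := by
  induction b generalizing c with
  | nil => exact (hb rfl).elim
  | cons b bs ih =>
    rw [letterActWord, FreeMonoid.ofList_cons, FreeMonoid.ofList_cons, wordAct_mul, wordAct_mul]
    by_cases h : bs = []
    · subst h
      simp only [letterActWord, FreeMonoid.ofList_nil, wordAct_one, wordAct_of_none,
        wordAct_of_some]
    · rw [ih _ h, ← wordAct_mul, ← wordAct_mul (.of c), wordAct_of_mul_of hr c b]

theorem wordAct_leftAct_none (hr : IsLNDIdempotentSolution r) (a : List X) {b : List X}
    (hb : b ≠ []) : wordAct r (.ofList (leftAct r a b)) none =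
      wordAct r (.ofList a) (wordAct r (.ofList b) none) := by
  induction a with
  | nil => rw [leftAct, FreeMonoid.ofList_nil, wordAct_one]
  | cons a as ih =>
    have h : leftAct r as b ≠ [] := by
      rw [← List.length_pos_iff, length_leftAct]; exact List.length_pos_iff.2 hb
    rw [leftAct, wordAct_letterActWord_none hr a h, ih, FreeMonoid.ofList_cons, wordAct_mul]

end WordAct

/-! ### The congruence of words -/

section WordCon

variable (k : Type*) [Field k] {X : Type*} {r : X × X → X × X}

theorem wordCon_of_mul_of (x y : X) :
    wordCon k r (.of x * .of y) (.of (r (x, y)).1 * .of (r (x, y)).2) := by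
  by_cases h : r (x, y) = (x, y)
  · rw [h]; exact (wordCon k r).refl _
  · exact TwoSidedIdeal.subset_span ⟨x, y, h, rfl⟩

/-- Extended linearly to monoid algebras, `g` kills the ideal, and distinct elements of M stay
distinct in the monoid algebra. -/
theorem map_eq_of_wordCon {M : Type*} [Monoid M] (g : FreeMonoid X →* M)
    (hg : ∀ x y, g (.of x * .of y) = g (.of (r (x, y)).1 * .of (r (x, y)).2))
    {u w : FreeMonoid X} (h : wordCon k r u w) : g u = g w := by
  let D : FreeAlg k X →ₐ[k] MonoidAlgebra k M := MonoidAlgebra.mapDomainAlgHom k k g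
  have hD : ∀ w : FreeMonoid X, D (mono k w) = MonoidAlgebra.single (g w) 1 := by
    intro w
    simp [D, mono]
  have hle : ybIdeal k r ≤ TwoSidedIdeal.ker D := by
    refine TwoSidedIdeal.span_le.2 ?_
    rintro _ ⟨x, y, -, rfl⟩
    rw [SetLike.mem_coe, TwoSidedIdeal.mem_ker, map_sub, hD, hD, hg, sub_self]
  have h0 := (TwoSidedIdeal.mem_ker _).1 (hle h)
  rw [map_sub, hD, hD, sub_eq_zero] at h0
  exact MonoidAlgebra.single_left_injective (one_ne_zero (α := k)) h0

theorem wordAct_eq_of_wordCon (hr : IsLNDIdempotentSolution r) {u w : FreeMonoid X}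
    (h : wordCon k r u w) : wordAct r u = wordAct r w :=
  map_eq_of_wordCon k (wordAct r) (wordAct_of_mul_of hr) h

/-- The class of xy depends only on ˣy, since xy is congruent to (ˣy)(q (ˣy)); choose z on which x₁
takes the value ˣy. -/
theorem exists_wordCon_of_mul (hr : IsLNDIdempotentSolution r) (x₁ x y : X) :
    ∃ z, wordCon k r (.of x * .of y) (.of x₁ * .of z) := by
  obtain ⟨q, hq⟩ := hr.exists_isDiagonalMap
  obtain ⟨z, hz⟩ := (hr.leftNondegenerate x₁).2 (r (x, y)).1
  dsimp only at hz
  refine ⟨z, (wordCon k r).trans (wordCon_of_mul_of k x y)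
    ((wordCon k r).symm ?_)⟩
  rw [hq.snd_eq x y, ← hz, ← hq.snd_eq]
  exact wordCon_of_mul_of k x₁ z

/-- Move a common first letter to the front of both words; it acts injectively, so the remaining
words have equal values and induction applies. -/
theorem wordCon_of_wordAct_none (hr : IsLNDIdempotentSolution r) (m : ℕ) (u w : FreeMonoid X)
    (hu : u.length = m) (hw : w.length = m) (h : wordAct r u none = wordAct r w none) :
    wordCon k r u w := by
  induction m generalizing u w with
  | zero =>
    rw [FreeMonoid.length_eq_zero.1 hu, FreeMonoid.length_eq_zero.1 hw]
    exact (wordCon k r).refl _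
  | succ m ih =>
    obtain rfl | m := m
    · obtain ⟨x, rfl⟩ := FreeMonoid.length_eq_one.1 hu
      obtain ⟨y, rfl⟩ := FreeMonoid.length_eq_one.1 hw
      rw [wordAct_of_none, wordAct_of_none, Option.some_inj] at h
      rw [h]
      exact (wordCon k r).refl _
    · have key : ∀ (x₁ : X) (u : FreeMonoid X), u.length = m + 2 →
          ∃ u', u'.length = m + 1 ∧ wordCon k r u (.of x₁ * u') := by
        intro x₁ u hu
        obtain ⟨x, y, u', rfl⟩ : ∃ x y u', u = .of x * (.of y * u') := by
          cases u using FreeMonoid.inductionOn' with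
          | one => simp at hu
          | of_mul x u =>
            cases u using FreeMonoid.inductionOn' with
            | one => simp at hu
            | of_mul y u => exact ⟨x, y, u, rfl⟩
        obtain ⟨z, hz⟩ := exists_wordCon_of_mul k hr x₁ x y
        refine ⟨.of z * u', by simp at hu ⊢; omega, ?_⟩
        rw [← mul_assoc, ← mul_assoc]
        exact (wordCon k r).mul hz ((wordCon k r).refl _)
      obtain ⟨x₁, -⟩ : ∃ x₁ : X, True := by
        cases u using FreeMonoid.inductionOn' with
        | one => simp at hu
        | of_mul x u => exact ⟨x, trivial⟩
      obtain ⟨u', hu', hcu⟩ := key x₁ u hu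
      obtain ⟨w', hw', hcw⟩ := key x₁ w hw
      refine (wordCon k r).trans hcu ((wordCon k r).trans ?_ ((wordCon k r).symm hcw))
      refine (wordCon k r).mul ((wordCon k r).refl _) (ih _ _ hu' hw' ?_)
      rw [wordAct_eq_of_wordCon k hr hcu, wordAct_eq_of_wordCon k hr hcw, wordAct_mul,
        wordAct_mul] at h
      obtain ⟨s, hs⟩ := exists_wordAct_none (r := r) (w := u') (by omega)
      obtain ⟨t, ht⟩ := exists_wordAct_none (r := r) (w := w') (by omega)
      rw [hs, ht] at h ⊢
      rw [wordAct_some_injective hr.leftNondegenerate _ h]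

/-- Two words are congruent if and only if they have the same length and the same value. -/
theorem wordCon_iff (hr : IsLNDIdempotentSolution r) {u w : FreeMonoid X} :
    wordCon k r u w ↔ u.length = w.length ∧ wordAct r u none = wordAct r w none :=
  ⟨fun h => ⟨ybIdeal_length k h, by rw [wordAct_eq_of_wordCon k hr h]⟩,
    fun h => wordCon_of_wordAct_none k hr _ u w rfl h.1.symm h.2⟩

theorem wordCon_letterActWord (c : X) (b : List X) :
    wordCon k r (.of c * .ofList b)
      (.ofList (letterActWord r c b) * .of (letterActedByWord r c b)) := by
  induction b generalizing c with
  | nil => exact (wordCon k r).refl _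
  | cons b bs ih =>
    rw [letterActWord, letterActedByWord, FreeMonoid.ofList_cons, FreeMonoid.ofList_cons,
      ← mul_assoc]
    refine (wordCon k r).trans
      ((wordCon k r).mul (wordCon_of_mul_of k c b) ((wordCon k r).refl _)) ?_
    rw [mul_assoc, mul_assoc]
    exact (wordCon k r).mul ((wordCon k r).refl _) (ih _)

theorem wordCon_leftAct_mul_rightAct (a b : List X) :
    wordCon k r (.ofList a * .ofList b)
      (.ofList (leftAct r a b) * .ofList (rightAct r a b)) := by
  induction a with
  | nil =>
    rw [leftAct, rightAct, FreeMonoid.ofList_nil, one_mul, mul_one]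
    exact (wordCon k r).refl _
  | cons a as ih =>
    rw [leftAct, rightAct, FreeMonoid.ofList_cons, FreeMonoid.ofList_cons, mul_assoc]
    refine (wordCon k r).trans ((wordCon k r).mul ((wordCon k r).refl _) ih) ?_
    rw [← mul_assoc, ← mul_assoc]
    exact (wordCon k r).mul (wordCon_letterActWord k a _) ((wordCon k r).refl _)

theorem ybMk_eq_ybMk_iff {f g : FreeAlg k X} : ybMk k r f = ybMk k r g ↔ f - g ∈ ybIdeal k r :=
  (RingCon.eq _).trans (TwoSidedIdeal.rel_iff _ _ _)

theorem ybMk_eq_zero_iff {f : FreeAlg k X} : ybMk k r f = 0 ↔ f ∈ ybIdeal k r := by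
  rw [← map_zero (ybMk k r), ybMk_eq_ybMk_iff, sub_zero]

theorem ybMk_surjective : Function.Surjective (ybMk k r) := RingCon.mk'_surjective _

theorem ybWord_eq_iff {u w : FreeMonoid X} :
    ybWord k r u = ybWord k r w ↔ wordCon k r u w :=
  ybMk_eq_ybMk_iff k

variable {k} in
theorem freeAlg_hom_ext {A : Type*} [Ring A] [Algebra k A] {φ ψ : FreeAlg k X →ₐ[k] A}
    (h : ∀ w, φ (mono k w) = ψ (mono k w)) : φ = ψ :=
  MonoidAlgebra.algHom_ext h (Subsingleton.elim _ _)

/-- The Yang-Baxter algebra is the monoid algebra of the words modulo congruence, because its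
relations only identify words. -/
theorem mem_ybIdeal_iff {f : FreeAlg k X} :
    f ∈ ybIdeal k r ↔ MonoidAlgebra.mapDomainAlgHom k k (wordCon k r).mk' f = 0 := by
  constructor
  · intro h
    refine (TwoSidedIdeal.mem_ker _).1
      ((TwoSidedIdeal.span_le (I := TwoSidedIdeal.ker _)).2 ?_ h)
    rintro _ ⟨x, y, -, rfl⟩
    rw [SetLike.mem_coe, TwoSidedIdeal.mem_ker, map_sub, sub_eq_zero]
    simp only [mono, MonoidAlgebra.of_apply, MonoidAlgebra.mapDomainAlgHom_apply,
      MonoidAlgebra.mapDomain_single]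
    exact congrArg (MonoidAlgebra.single · 1) ((Con.eq _).2 (wordCon_of_mul_of k x y))
  · intro h
    let g : (wordCon k r).Quotient →* YBAlgebra k r :=
      (wordCon k r).lift (((ybMk k r : FreeAlg k X →* YBAlgebra k r)).comp
        (MonoidAlgebra.of k (FreeMonoid X))) fun u w huw => (ybWord_eq_iff k).2 huw
    have hg : ybMk k r = (MonoidAlgebra.lift k _ _ g).comp
        (MonoidAlgebra.mapDomainAlgHom k k (wordCon k r).mk') := by
      refine freeAlg_hom_ext fun w => ?_
      simp [g]
      rfl
    rw [← ybMk_eq_zero_iff, hg, AlgHom.comp_apply, h, map_zero]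

/-- A homomorphism of free monoids that preserves and reflects the congruences of words
preserves and reflects the ideals of relations. -/
theorem mapDomain_mem_ybIdeal_iff {Y : Type*} {r' : Y × Y → Y × Y}
    (h : FreeMonoid Y →* FreeMonoid X)
    (hh : ∀ u w, wordCon k r' u w ↔ wordCon k r (h u) (h w)) {f : FreeAlg k Y} :
    MonoidAlgebra.mapDomainAlgHom k k h f ∈ ybIdeal k r ↔ f ∈ ybIdeal k r' := by
  let j : (wordCon k r').Quotient →* (wordCon k r).Quotient :=
    (wordCon k r').lift ((wordCon k r).mk'.comp h) fun u w huw =>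
      (Con.eq _).2 ((hh u w).1 huw)
  have hj : Function.Injective j := by
    intro a b
    induction a using Con.induction_on with | H a => ?_
    induction b using Con.induction_on with | H b => ?_
    exact fun hab => (Con.eq _).2 ((hh a b).2 ((Con.eq _).1 hab))
  have hc : (MonoidAlgebra.mapDomainAlgHom k k (wordCon k r).mk').comp
      (MonoidAlgebra.mapDomainAlgHom k k h) =
      (MonoidAlgebra.mapDomainAlgHom k k j).comp
        (MonoidAlgebra.mapDomainAlgHom k k (wordCon k r').mk') := by
    refine freeAlg_hom_ext fun w => ?_
    simp [j]
    rfl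
  rw [mem_ybIdeal_iff, mem_ybIdeal_iff, ← AlgHom.comp_apply, hc, AlgHom.comp_apply]
  exact map_eq_zero_iff _ (MonoidAlgebra.mapDomain_injective hj)

end WordCon

/-! ### Normal words -/

section NormalWords

variable (k : Type*) [Field k] {X : Type*} {r : X × X → X × X}

theorem coeff_mono_sub_mono (s t : FreeMonoid X) :
    (mono k t - mono k s).coeff = Finsupp.single t (1 : k) - Finsupp.single s 1 := rfl

theorem of_mul_of_ne {x y : X} (h : x ≠ y) (u w : X) :
    (.of x * .of u : FreeMonoid X) ≠ .of y * .of w := fun he =>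
  h (List.cons.inj he).1

theorem length_pow_mul_of (x₁ x : X) (m : ℕ) :
    (.of x₁ ^ m * .of x : FreeMonoid X).length = m + 1 := by
  induction m with
  | zero => simp
  | succ m ih => rw [pow_succ', mul_assoc, FreeMonoid.length_mul, ih, FreeMonoid.length_of,
      add_comm]

theorem pow_mul_of_injective (x₁ : X) (m : ℕ) :
    Function.Injective fun x => (.of x₁ ^ m * .of x : FreeMonoid X) := fun _ _ h =>
  FreeMonoid.of_injective (mul_left_cancel h)

variable [LinearOrder X]

theorem isLeadingMonomial_mono_sub_mono {s t : FreeMonoid X} (hst : s ≠ t) (hlt : DegLex s t) :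
    IsLeadingMonomial (mono k t - mono k s) t := by
  classical
  refine ⟨?_, fun v hv hvt => ?_⟩
  · rw [coeff_mono_sub_mono]; simp [hst]
  · rw [coeff_mono_sub_mono] at hv
    by_cases hvs : v = s
    · exact hvs ▸ hlt
    · simp [Ne.symm hvt, Ne.symm hvs] at hv

theorem degLex_of_lt {x y : X} (h : x < y) (u w : X) :
    DegLex (.of x * .of u : FreeMonoid X) (.of y * .of w) :=
  List.Shortlex.of_lex rfl (List.Lex.rel h)

theorem eq_pow_mul_of_or_exists (x₁ : X) (w : FreeMonoid X) :
    w = 1 ∨ (∃ m x, w = .of x₁ ^ m * .of x) ∨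
      ∃ a x y b, x ≠ x₁ ∧ w = a * (.of x * .of y) * b := by
  induction w using FreeMonoid.inductionOn' with
  | one => exact .inl rfl
  | of_mul c w ih =>
    right
    rcases ih with rfl | ⟨m, x, rfl⟩ | ⟨a, x, y, b, hx, rfl⟩
    · exact .inl ⟨0, c, by simp⟩
    · by_cases hc : c = x₁
      · exact .inl ⟨m + 1, x, by rw [hc, pow_succ', mul_assoc]⟩
      · cases m with
        | zero => exact .inr ⟨1, c, x, 1, hc, by simp⟩
        | succ m => exact .inr ⟨1, c, x₁, .of x₁ ^ m * .of x, hc, by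
            simp only [pow_succ', mul_assoc, one_mul]⟩
    · exact .inr ⟨.of c * a, x, y, b, hx, by simp only [mul_assoc]⟩

variable {x₁ : X}

/-- A lexicographically smaller word would also start with the least letter x₁; cancelling that
letter from both values allows induction. -/
theorem not_lex_of_wordAct_none (hx₁ : IsBot x₁) (hr : IsLNDIdempotentSolution r) (m : ℕ) (x : X)
    (v : FreeMonoid X) (hl : v.length = m + 1)
    (hv : wordAct r v none = wordAct r (.of x₁ ^ m * .of x) none) :
    ¬ List.Lex (· < ·) v.toList (.of x₁ ^ m * .of x : FreeMonoid X).toList := by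
  induction m generalizing v with
  | zero =>
    obtain ⟨y, rfl⟩ := FreeMonoid.length_eq_one.1 hl
    rw [pow_zero, one_mul, wordAct_of_none, wordAct_of_none, Option.some_inj] at hv
    rw [hv, pow_zero, one_mul]
    exact irrefl _
  | succ m ih =>
    induction v using FreeMonoid.inductionOn' with
    | one => simp at hl
    | of_mul y v _ =>
      have hl' : v.length = m + 1 := by
        rw [FreeMonoid.length_mul, FreeMonoid.length_of] at hl; omega
      rw [pow_succ', mul_assoc] at hv ⊢
      rw [FreeMonoid.toList_mul, FreeMonoid.toList_mul (.of x₁), FreeMonoid.toList_of,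
        FreeMonoid.toList_of, List.singleton_append, List.singleton_append]
      intro h
      cases h with
      | rel h => exact (hx₁ y).not_gt h
      | cons h =>
        refine ih v hl' ?_ h
        rw [wordAct_mul, wordAct_mul] at hv
        obtain ⟨s, hs⟩ := exists_wordAct_none (r := r) (w := v) (by omega)
        obtain ⟨t, ht⟩ := exists_wordAct_none (r := r) (w := .of x₁ ^ m * .of x) (by simp)
        rw [hs, ht] at hv ⊢
        rw [wordAct_some_injective hr.leftNondegenerate _ hv]

theorem isNormalMod_pow_mul_of (hx₁ : IsBot x₁) (hr : IsLNDIdempotentSolution r) (m : ℕ) (x : X) :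
    IsNormalMod (ybIdeal k r : Set (FreeAlg k X)) (.of x₁ ^ m * .of x) := by
  intro f hf u hu a b hab
  obtain ⟨v, hvu, hv⟩ := exists_smaller k hf hu
  have hc : wordCon k r (a * v * b) (a * u * b) :=
    (wordCon k r).mul ((wordCon k r).mul ((wordCon k r).refl _) hv) ((wordCon k r).refl _)
  have hd := degLex_mul (a := a) (b := b) (ybIdeal_length k hv) hvu
  rw [← hab] at hc hd
  have hl := ybIdeal_length k hc
  exact not_lex_of_wordAct_none hx₁ hr m x _ (hl.trans (length_pow_mul_of _ _ _))
    (by rw [wordAct_eq_of_wordCon k hr hc]) ((List.shortlex_iff_lex hl).1 hd)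

theorem eq_pow_mul_of_of_isNormalMod (hx₁ : IsBot x₁) (hr : IsLNDIdempotentSolution r)
    {w : FreeMonoid X} {m : ℕ} (hw : IsNormalMod (ybIdeal k r : Set (FreeAlg k X)) w)
    (hl : w.length = m + 1) : ∃ x, w = .of x₁ ^ m * .of x := by
  rcases eq_pow_mul_of_or_exists x₁ w with rfl | ⟨n, x, rfl⟩ | ⟨a, x, y, b, hx, rfl⟩
  · simp at hl
  · rw [length_pow_mul_of, Nat.add_right_cancel_iff] at hl
    exact ⟨x, by rw [hl]⟩
  · obtain ⟨z, hz⟩ := exists_wordCon_of_mul k hr x₁ x y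
    exact (hw _ hz _ (isLeadingMonomial_mono_sub_mono k (of_mul_of_ne hx.symm _ _)
      (degLex_of_lt (lt_of_le_of_ne (hx₁ x) hx.symm) _ _)) a b rfl).elim

/-- The bijection `x ↦ x₁^{d-1} x` between letters and normal words of length `d`. -/
noncomputable def normalWordEquiv (hx₁ : IsBot x₁) (hr : IsLNDIdempotentSolution r) {d : ℕ}
    (hd : d ≠ 0) : X ≃ NormalWord k r d :=
  Equiv.ofBijective (fun x => ⟨.of x₁ ^ (d - 1) * .of x, isNormalMod_pow_mul_of k hx₁ hr _ x, by
      rw [length_pow_mul_of]; omega⟩)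
    ⟨fun _ _ h => pow_mul_of_injective x₁ _ (congrArg Subtype.val h), fun w => by
      obtain ⟨x, hx⟩ := eq_pow_mul_of_of_isNormalMod (m := d - 1) k hx₁ hr w.2.1
        (w.2.2.trans (by omega))
      exact ⟨x, Subtype.ext hx.symm⟩⟩

theorem wordCon_nor [Finite X] (r : X × X → X × X) (w : FreeMonoid X) :
    wordCon k r w (nor k r w) :=
  (existsUnique_normalForm k r w).choose_spec.1.2

theorem eq_of_isNormalMod_of_wordCon [Finite X] {u w : FreeMonoid X}
    (hu : IsNormalMod (ybIdeal k r : Set (FreeAlg k X)) u)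
    (hw : IsNormalMod (ybIdeal k r : Set (FreeAlg k X)) w) (h : wordCon k r u w) : u = w :=
  (existsUnique_normalForm k r u).unique ⟨hu, (wordCon k r).refl u⟩ ⟨hw, h⟩

end NormalWords

/-! ### The PBW presentation of a Yang-Baxter algebra -/

section PBW

variable (k : Type*) [Field k] {X : Type*} {r : X × X → X × X}

theorem evalAt_mono_of {A : Type*} [Ring A] [Algebra k A] (g : X → A) (x : X) :
    evalAt (k := k) g (mono k (.of x)) = g x := by
  simp [evalAt]

theorem evalAt_eq {A : Type*} [Ring A] [Algebra k A] {g : X → A} {φ : FreeAlg k X →ₐ[k] A}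
    (h : ∀ x, φ (mono k (.of x)) = g x) : evalAt (k := k) g = φ := by
  refine freeAlg_hom_ext fun w => ?_
  induction w using FreeMonoid.inductionOn' with
  | one => simp only [mono, map_one]
  | of_mul x w ih => rw [mono, map_mul, map_mul, map_mul, ih, evalAt_mono_of, ← h]

theorem evalAt_ybGen : evalAt (k := k) (ybGen k r) = ybMk k r :=
  evalAt_eq k fun _ => rfl

theorem ker_ybMk : TwoSidedIdeal.ker (ybMk k r) = ybIdeal k r := by
  ext f
  rw [TwoSidedIdeal.mem_ker, ybMk_eq_zero_iff]

theorem quadratic_standardRelations (x₁ : X) (p : X → X → X) :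
    ∀ f ∈ standardRelations k x₁ p, f ∈ wordSpan k X 2 := by
  rintro _ ⟨x, y, -, rfl⟩
  have h : ∀ u w : X, mono k (.of u * .of w) ∈ wordSpan k X 2 := fun u w =>
    Submodule.subset_span ⟨_, rfl, rfl⟩
  exact sub_mem (h _ _) (h _ _)

theorem finite_standardRelations [Finite X] (x₁ : X) (p : X → X → X) :
    (standardRelations k x₁ p).Finite := by
  refine (Set.finite_range fun t : X × X => mono k (.of t.1 * .of t.2) -
    mono k (.of x₁ * .of (p t.1 t.2))).subset ?_
  rintro _ ⟨x, y, -, rfl⟩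
  exact ⟨(x, y), rfl⟩

theorem span_standardRelations (hr : IsLNDIdempotentSolution r) (x₁ : X) (p : X → X → X)
    (hp : ∀ x y, wordCon k r (.of x * .of y) (.of x₁ * .of (p x y))) :
    TwoSidedIdeal.span (standardRelations k x₁ p) = ybIdeal k r := by
  have hinj : ∀ {s t : X}, wordCon k r (.of x₁ * .of s) (.of x₁ * .of t) → s = t := by
    intro s t h
    have h' := congrFun (wordAct_eq_of_wordCon k hr h) none
    rw [wordAct_mul, wordAct_mul, wordAct_of_none, wordAct_of_none] at h'
    exact wordAct_some_injective hr.leftNondegenerate _ h'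
  refine le_antisymm (TwoSidedIdeal.span_le.2 ?_) (TwoSidedIdeal.span_le.2 ?_)
  · rintro _ ⟨x, y, -, rfl⟩
    exact hp x y
  -- The relation for x = x₁ is absent from the set, but cancelling x₁ gives p x₁ y = y, so it is
  -- trivial. Each defining relation is then a difference of two relations with the same second
  -- term.
  · have hmem : ∀ x y, mono k (.of x * .of y) - mono k (.of x₁ * .of (p x y)) ∈
        TwoSidedIdeal.span (standardRelations k x₁ p) := by
      intro x y
      by_cases hx : x = x₁
      · subst hx
        rw [← hinj (hp x y), sub_self]
        exact zero_mem _
      · exact TwoSidedIdeal.subset_span ⟨x, y, hx, rfl⟩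
    rintro _ ⟨x, y, -, rfl⟩
    have h : p x y = p (r (x, y)).1 (r (x, y)).2 :=
      hinj ((wordCon k r).trans ((wordCon k r).symm (hp x y))
        ((wordCon k r).trans (wordCon_of_mul_of k x y) (hp _ _)))
    have h' := sub_mem (hmem x y) (hmem (r (x, y)).1 (r (x, y)).2)
    rw [← h, sub_sub_sub_cancel_right] at h'
    exact h'

variable [LinearOrder X] {x₁ : X}

/-- A leading monomial of the ideal is not normal, so it is neither empty nor of the form x₁^m x; it
must contain some xy with x ≠ x₁, the leading monomial of a relation. -/
theorem isGroebnerBasis_standardRelations (hx₁ : IsBot x₁) (hr : IsLNDIdempotentSolution r)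
    (p : X → X → X) (hp : ∀ x y, wordCon k r (.of x * .of y) (.of x₁ * .of (p x y))) :
    IsGroebnerBasis (standardRelations k x₁ p) (ybIdeal k r) where
  monic := by
    rintro _ ⟨x, y, hx, rfl⟩
    refine ⟨_, isLeadingMonomial_mono_sub_mono k (of_mul_of_ne hx.symm _ _)
      (degLex_of_lt (lt_of_le_of_ne (hx₁ x) hx.symm) _ _), ?_⟩
    rw [coeff_mono_sub_mono, Finsupp.sub_apply, Finsupp.single_eq_same,
      Finsupp.single_eq_of_ne (of_mul_of_ne hx _ _), sub_zero]
  span_eq := span_standardRelations k hr x₁ p hp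
  divides := by
    intro f hf u hu
    rcases eq_pow_mul_of_or_exists x₁ u with rfl | ⟨m, x, rfl⟩ | ⟨a, x, y, b, hx, rfl⟩
    · obtain ⟨v, hv, -⟩ := exists_smaller k hf hu
      exact (List.not_shortlex_nil_right hv).elim
    · exact (isNormalMod_pow_mul_of k hx₁ hr m x f hf _ hu 1 1 (by simp)).elim
    · exact ⟨_, ⟨x, y, hx, rfl⟩, _, isLeadingMonomial_mono_sub_mono k (of_mul_of_ne hx.symm _ _)
        (degLex_of_lt (lt_of_le_of_ne (hx₁ x) hx.symm) _ _), a, b, rfl⟩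

theorem isPBWPresentation_ybAlgebra [Finite X] (hx₁ : IsBot x₁) (hr : IsLNDIdempotentSolution r)
    (p : X → X → X) (hp : ∀ x y, wordCon k r (.of x * .of y) (.of x₁ * .of (p x y))) :
    IsPBWPresentation (ybGrading k r) (ybGen k r) (standardRelations k x₁ p) where
  surjective := by rw [evalAt_ybGen]; exact ybMk_surjective k
  graded m := by rw [evalAt_ybGen]; rfl
  finite := finite_standardRelations k x₁ p
  quadratic := quadratic_standardRelations k x₁ p
  groebner := by
    rw [evalAt_ybGen, ker_ybMk]
    exact isGroebnerBasis_standardRelations k hx₁ hr p hp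

theorem IsPBWPresentation.map {A B : Type*} [Ring A] [Algebra k A] [Ring B] [Algebra k B]
    {𝒜 : ℕ → Submodule k A} {ℬ : ℕ → Submodule k B} {g : X → A} {R : Set (FreeAlg k X)}
    (h : IsPBWPresentation 𝒜 g R) (φ : A ≃ₐ[k] B) {g' : X → B} (hg : ∀ x, φ (g x) = g' x)
    (hφ : ∀ m, (𝒜 m).map φ.toLinearMap = ℬ m) : IsPBWPresentation ℬ g' R := by
  have he : evalAt (k := k) g' = (φ : A →ₐ[k] B).comp (evalAt (k := k) g) :=
    evalAt_eq k fun x => by rw [AlgHom.comp_apply, evalAt_mono_of]; exact hg x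
  have hk : TwoSidedIdeal.ker (evalAt (k := k) g') = TwoSidedIdeal.ker (evalAt (k := k) g) := by
    ext f
    rw [TwoSidedIdeal.mem_ker, TwoSidedIdeal.mem_ker, he, AlgHom.comp_apply]
    exact map_eq_zero_iff φ φ.injective
  refine ⟨?_, fun m => ?_, h.finite, h.quadratic, hk ▸ h.groebner⟩
  · rw [he]; exact φ.surjective.comp h.surjective
  · rw [he, ← hφ, ← h.graded, ← Submodule.map_comp]; rfl

end PBW

/-! ### The Veronese solution -/

section VeroneseSolution

variable (k : Type*) [Field k] {X : Type*} [LinearOrder X] {r : X × X → X × X} {d : ℕ}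

/-- Normal words of the same length and value are congruent, hence equal; surjectivity follows by
counting, since there are as many normal words as letters. -/
theorem exists_normalWord_value [Finite X] {x₁ : X} (hx₁ : IsBot x₁)
    (hr : IsLNDIdempotentSolution r) (hd : d ≠ 0) :
    ∃ Φ : NormalWord k r d ≃ X, ∀ w, wordAct r w.1 none = some (Φ w) := by
  choose Φ hΦ using fun w : NormalWord k r d =>
    exists_wordAct_none (r := r) (w := w.1) (by rw [w.2.2]; exact hd)
  have hinj : Function.Injective Φ := fun u w h => Subtype.ext <|
    eq_of_isNormalMod_of_wordCon k u.2.1 w.2.1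
      ((wordCon_iff k hr).2 ⟨u.2.2.trans w.2.2.symm, by rw [hΦ, hΦ, h]⟩)
  have hsurj := Finite.surjective_of_injective
    (hinj.comp (normalWordEquiv k hx₁ hr hd).injective)
  exact ⟨Equiv.ofBijective Φ ⟨hinj, hsurj.of_comp⟩, hΦ⟩

theorem wordAct_nor_none [Finite X] (hr : IsLNDIdempotentSolution r) (w : FreeMonoid X)
    (o : Option X) : wordAct r (nor k r w) o = wordAct r w o := by
  rw [wordAct_eq_of_wordCon k hr (wordCon_nor k r w)]

theorem wordAct_veroneseSolution_fst [Finite X] (hr : IsLNDIdempotentSolution r) (hd : d ≠ 0)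
    (a b : NormalWord k r d) : wordAct r (veroneseSolution k r d (a, b)).1.1 none =
      wordAct r a.1 (wordAct r b.1 none) := by
  refine (wordAct_nor_none k hr _ _).trans (wordAct_leftAct_none hr _ ?_)
  exact List.ne_nil_of_length_pos ((Nat.pos_of_ne_zero hd).trans_eq b.2.2.symm)

theorem wordCon_veroneseSolution [Finite X] (a b : NormalWord k r d) :
    wordCon k r (a.1 * b.1)
      ((veroneseSolution k r d (a, b)).1.1 * (veroneseSolution k r d (a, b)).2.1) :=
  (wordCon k r).trans (wordCon_leftAct_mul_rightAct k a.1.toList b.1.toList)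
    ((wordCon k r).mul (wordCon_nor k r _) (wordCon_nor k r _))

theorem isLNDIdempotentSolution_veroneseSolution [Finite X] {x₁ : X} (hx₁ : IsBot x₁)
    (hr : IsLNDIdempotentSolution r) (hd : d ≠ 0) :
    IsLNDIdempotentSolution (veroneseSolution k r d) := by
  obtain ⟨q, hq⟩ := hr.exists_isDiagonalMap
  obtain ⟨Φ, hΦ⟩ := exists_normalWord_value k hx₁ hr hd
  have hact : ∀ a b, wordAct r a.1 (some (Φ b)) =
      some (Φ (veroneseSolution k r d (a, b)).1) := fun a b => by
    rw [← hΦ, ← hΦ, wordAct_veroneseSolution_fst k hr hd]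
  have hiter : ∀ a : NormalWord k r d, wordAct r a.1 (some (q^[d] (Φ a))) = some (Φ a) :=
    fun a => by simpa only [a.2.2] using hq.wordAct_iterate a.1 (hΦ a)
  have hmul : ∀ a b o, wordAct r a.1 (wordAct r b.1 o) =
      wordAct r (veroneseSolution k r d (a, b)).1.1
        (wordAct r (veroneseSolution k r d (a, b)).2.1 o) := fun a b o => by
    rw [← wordAct_mul, wordAct_eq_of_wordCon k hr (wordCon_veroneseSolution k a b), wordAct_mul]
  -- Conjugated by the value map, q^[d] is the diagonal map. For the first identity, evaluate `hmul`
  -- at `none` and cancel the action of the first component of ρ_d (a, b).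
  have hdiag : IsDiagonalMap (veroneseSolution k r d) fun a => Φ.symm (q^[d] (Φ a)) := by
    refine ⟨fun a b => ?_, fun a => ?_, fun a b => ?_⟩
    · rw [Equiv.eq_symm_apply]
      refine wordAct_some_injective hr.leftNondegenerate
        (veroneseSolution k r d (a, b)).1.1 ?_
      rw [hiter, ← hΦ (veroneseSolution k r d (a, b)).2, ← hmul, hΦ, hact]
    · rw [← Φ.apply_eq_iff_eq, ← Option.some_inj, ← hact, Equiv.apply_symm_apply, hiter]
    · have h := hq.iterate_eq a.1 hd (hact a b)
      rw [a.2.2, Function.iterate_add_apply] at h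
      rw [Equiv.apply_symm_apply, h]
  have : Finite (NormalWord k r d) := .of_equiv X Φ.symm
  refine hdiag.isLNDIdempotentSolution (fun a => Finite.injective_iff_bijective.1 ?_) ?_
  · intro b c h
    have h' := congrArg (fun w => some (Φ w)) h
    dsimp only at h'
    rw [← hact, ← hact] at h'
    exact Φ.injective (wordAct_some_injective hr.leftNondegenerate _ h')
  · intro a b c
    rw [← Φ.apply_eq_iff_eq, ← Option.some_inj]
    simp only [← hact]
    exact hmul a b _

end VeroneseSolution

/-! ### The Veronese morphism -/

section VeroneseMorphism

variable (k : Type*) [Field k] {X : Type*} {r : X × X → X × X} {d : ℕ}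

theorem iSup_wordSpan (X : Type*) : ⨆ m, wordSpan k X m = ⊤ := by
  refine eq_top_iff.2 fun f _ => ?_
  induction f using MonoidAlgebra.induction_linear with
  | zero => exact zero_mem _
  | add f g hf hg => exact add_mem (hf trivial) (hg trivial)
  | single w c =>
    have h : MonoidAlgebra.single w c = c • mono k w := by simp [mono]
    rw [h]
    exact Submodule.smul_mem _ _ (Submodule.mem_iSup_of_mem _ (mono_mem_wordSpan k w))

theorem iSup_ybGrading (r : X × X → X × X) : ⨆ m, ybGrading k r m = ⊤ := by
  simp only [ybGrading]
  rw [← Submodule.map_iSup, iSup_wordSpan, Submodule.map_top, LinearMap.range_eq_top]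
  exact ybMk_surjective k

theorem ybGrading_eq_span (r : X × X → X × X) (m : ℕ) :
    ybGrading k r m = Submodule.span k (ybWord k r '' {w | w.length = m}) := by
  rw [ybGrading, wordSpan, Submodule.map_span]
  congr 1
  ext a
  constructor
  · rintro ⟨_, ⟨w, hw, rfl⟩, rfl⟩
    exact ⟨w, hw, rfl⟩
  · rintro ⟨w, hw, rfl⟩
    exact ⟨_, ⟨w, hw, rfl⟩, rfl⟩

variable {k} [LinearOrder X] {Y : Type*}

/-- The homomorphism from words in a family of normal words of length `d` to words. -/
noncomputable def flatten (e : Y ≃ NormalWord k r d) : FreeMonoid Y →* FreeMonoid X :=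
  FreeMonoid.lift fun y => (e y).1

theorem flatten_of (e : Y ≃ NormalWord k r d) (y : Y) : flatten e (.of y) = (e y).1 :=
  FreeMonoid.lift_eval_of _ _

theorem flatten_of_mul_of (e : Y ≃ NormalWord k r d) (x y : Y) :
    flatten e (.of x * .of y) = (e x).1 * (e y).1 := by
  rw [map_mul, flatten_of, flatten_of]

theorem length_flatten (e : Y ≃ NormalWord k r d) (u : FreeMonoid Y) :
    (flatten e u).length = u.length * d := by
  induction u using FreeMonoid.inductionOn' with
  | one => simp
  | of_mul y u ih =>
    rw [map_mul, FreeMonoid.length_mul, ih, flatten_of, (e y).2.2, FreeMonoid.length_mul,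
      FreeMonoid.length_of, add_mul, one_mul]

/-- Cut the word into blocks of length d and replace each by its normal form. -/
theorem exists_wordCon_flatten [Finite X] (e : Y ≃ NormalWord k r d) (m : ℕ) (w : FreeMonoid X)
    (hw : w.length = m * d) : ∃ u, u.length = m ∧ wordCon k r (flatten e u) w := by
  induction m generalizing w with
  | zero =>
    rw [zero_mul] at hw
    refine ⟨1, rfl, ?_⟩
    rw [FreeMonoid.length_eq_zero.1 hw, map_one]
    exact (wordCon k r).refl _
  | succ m ih =>
    have hl : w.toList.length = (m + 1) * d := hw
    rw [add_mul, one_mul] at hl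
    obtain ⟨u, hu, hc⟩ := ih (.ofList (w.toList.drop d))
      ((List.length_drop (i := d) (l := w.toList)).trans (by omega))
    let a : FreeMonoid X := .ofList (w.toList.take d)
    have ha : a.length = d := (List.length_take (i := d) (l := w.toList)).trans (by omega)
    have hwa : w = a * .ofList (w.toList.drop d) := (List.take_append_drop d w.toList).symm
    let n : NormalWord k r d := ⟨nor k r a, nor_normal k r a, (length_nor k r a).trans ha⟩
    refine ⟨.of (e.symm n) * u, ?_, ?_⟩
    · rw [FreeMonoid.length_mul, FreeMonoid.length_of, hu, add_comm]
    · rw [map_mul, flatten_of, Equiv.apply_symm_apply]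
      conv_rhs => rw [hwa]
      exact (wordCon k r).mul ((wordCon k r).symm (wordCon_nor k r a)) hc

/-- By `hact`, values on both sides correspond under the injection Φ ∘ e, and lengths differ by the
factor d ≠ 0; `wordCon_iff` for both solutions concludes. -/
theorem wordCon_flatten_iff [Finite X] {x₁ : X} (hx₁ : IsBot x₁)
    (hr : IsLNDIdempotentSolution r) (hd : d ≠ 0) (e : Y ≃ NormalWord k r d)
    (u w : FreeMonoid Y) :
    wordCon k (transport e (veroneseSolution k r d)) u w ↔
      wordCon k r (flatten e u) (flatten e w) := by
  obtain ⟨Φ, hΦ⟩ := exists_normalWord_value k hx₁ hr hd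
  have hact : ∀ (u : FreeMonoid Y) (o : Option Y),
      wordAct r (flatten e u) (o.map fun y => Φ (e y)) =
        (wordAct (transport e (veroneseSolution k r d)) u o).map fun y => Φ (e y) := by
    intro u o
    induction u using FreeMonoid.inductionOn' with
    | one => rw [map_one, wordAct_one, wordAct_one]
    | of_mul y u ih =>
      rw [map_mul, wordAct_mul, ih, wordAct_mul, flatten_of]
      cases wordAct (transport e (veroneseSolution k r d)) u o with
      | none => rw [Option.map_none, hΦ, wordAct_of_none, Option.map_some]
      | some t =>
        rw [Option.map_some, ← hΦ, ← wordAct_veroneseSolution_fst k hr hd, wordAct_of_some,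
          Option.map_some, hΦ, transport, Equiv.apply_symm_apply]
  have hr' := (isLNDIdempotentSolution_veroneseSolution k hx₁ hr hd).transport e
  have hinj : Function.Injective (Option.map fun y => Φ (e y)) :=
    Option.map_injective (Φ.injective.comp e.injective)
  have h := fun u => hact u none
  rw [Option.map_none] at h
  rw [wordCon_iff k hr', wordCon_iff k hr, length_flatten, length_flatten, h, h, hinj.eq_iff,
    Nat.mul_left_inj hd]

theorem exists_veroneseMorphism [Finite X] {x₁ : X} (hx₁ : IsBot x₁)
    (hr : IsLNDIdempotentSolution r) (hd : d ≠ 0) (e : Y ≃ NormalWord k r d) :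
    ∃ ν : YBAlgebra k (transport e (veroneseSolution k r d)) →ₐ[k] YBAlgebra k r,
      (∀ y, ν (ybGen k _ y) = ybWord k r (e y).1) ∧ Function.Injective ν ∧
      (∀ m, (ybGrading k _ m).map ν.toLinearMap = ybGrading k r (m * d)) ∧
      ν.range = veronese (ybGrading k r) d := by
  have hmem : ∀ f, (ybMk k r) (MonoidAlgebra.mapDomainAlgHom k k (flatten e) f) = 0 ↔
      f ∈ ybIdeal k (transport e (veroneseSolution k r d)) := fun f => by
    rw [ybMk_eq_zero_iff]
    exact mapDomain_mem_ybIdeal_iff k (flatten e) (wordCon_flatten_iff hx₁ hr hd e)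
  let F : FreeAlg k Y →ₐ[k] YBAlgebra k r :=
    (ybMk k r).comp (MonoidAlgebra.mapDomainAlgHom k k (flatten e))
  let ν : YBAlgebra k (transport e (veroneseSolution k r d)) →ₐ[k] YBAlgebra k r :=
    (ybIdeal k (transport e (veroneseSolution k r d))).ringCon.liftₐ F fun {f g} hfg => by
      rw [TwoSidedIdeal.rel_iff, ← hmem, map_sub, map_sub, sub_eq_zero] at hfg
      exact hfg
  have hν : ∀ f, ν (ybMk k _ f) = F f := fun f => rfl
  have hword : ∀ u, ν (ybWord k _ u) = ybWord k r (flatten e u) := fun u => by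
    rw [ybWord, hν]
    simp [F, ybWord, mono]
  have hgr : ∀ m, (ybGrading k _ m).map ν.toLinearMap = ybGrading k r (m * d) := by
    intro m
    rw [ybGrading_eq_span, ybGrading_eq_span, Submodule.map_span]
    congr 1
    ext a
    constructor
    · rintro ⟨_, ⟨u, hu, rfl⟩, rfl⟩
      exact ⟨flatten e u, (length_flatten e u).trans (by rw [hu]), (hword u).symm⟩
    · rintro ⟨w, hw, rfl⟩
      obtain ⟨u, hu, hc⟩ := exists_wordCon_flatten e m w hw
      exact ⟨_, ⟨u, hu, rfl⟩, (hword u).trans ((ybWord_eq_iff k).2 hc)⟩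
  refine ⟨ν, fun y => ?_, (injective_iff_map_eq_zero ν).2 fun a ha => ?_, hgr, ?_⟩
  · rw [ybGen, hword, flatten_of]
  · obtain ⟨f, rfl⟩ := ybMk_surjective k a
    exact (ybMk_eq_zero_iff k).2 ((hmem f).1 ha)
  · refine Subalgebra.toSubmodule_injective ?_
    rw [veronese, Submodule.toSubalgebra_toSubmodule]
    simp only [← hgr]
    rw [← Submodule.map_iSup, iSup_ybGrading, Submodule.map_top]
    rfl

theorem exists_veroneseIsomorphism [Finite X] {x₁ : X} (hx₁ : IsBot x₁)
    (hr : IsLNDIdempotentSolution r) (hd : d ≠ 0) (e : Y ≃ NormalWord k r d) :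
    ∃ φ : YBAlgebra k (transport e (veroneseSolution k r d)) ≃ₐ[k] veronese (ybGrading k r) d,
      (∀ y, φ (ybGen k _ y) = veroneseGen k r d (e y)) ∧
      ∀ m, (ybGrading k _ m).map φ.toLinearMap = veroneseGrading (ybGrading k r) d m := by
  obtain ⟨ν, hgen, hinj, hgr, hrange⟩ := exists_veroneseMorphism hx₁ hr hd e
  let φ := (AlgEquiv.ofInjective ν hinj).trans (Subalgebra.equivOfEq _ _ hrange)
  have hφ : ∀ a, (φ a : YBAlgebra k r) = ν a := fun a => rfl
  refine ⟨φ, fun y => Subtype.ext (hgen y), fun m => ?_⟩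
  ext a
  rw [veroneseGrading, Submodule.mem_comap, ← hgr m]
  constructor
  · rintro ⟨b, hb, rfl⟩
    exact ⟨b, hb, rfl⟩
  · rintro ⟨b, hb, hba⟩
    exact ⟨b, hb, Subtype.ext hba⟩

end VeroneseMorphism

end YangBaxter
-- The Veronese theorem.
theorem theorem6 {k : Type*} [Field k] {X : Type*} [Finite X] [Nontrivial X] [LinearOrder X]
    (x₁ : X) (hx₁ : IsBot x₁) (r : X × X → X × X)
    (hr : YangBaxter.IsLNDIdempotentSolution r) (d : ℕ) (hd : 2 ≤ d) :
    YangBaxter.IsLNDIdempotentSolution (YangBaxter.veroneseSolution k r d) ∧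
    ∃ v : X ≃ YangBaxter.NormalWord k r d,
      (∀ x, (v x).1 = FreeMonoid.of x₁ ^ (d - 1) * FreeMonoid.of x) ∧
      YangBaxter.IsLNDIdempotentSolution (YangBaxter.veroneseProlongation k r d v) ∧
      (∃ p : X → X → X,
        (∀ x y, YangBaxter.nor k r ((v x).1 * (v y).1) = (v x₁).1 * (v (p x y)).1) ∧
        YangBaxter.IsPBWPresentation
          (YangBaxter.ybGrading k (YangBaxter.veroneseProlongation k r d v))
          (YangBaxter.ybGen k (YangBaxter.veroneseProlongation k r d v))
          (YangBaxter.standardRelations k x₁ p) ∧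
        YangBaxter.IsPBWPresentation
          (YangBaxter.veroneseGrading (YangBaxter.ybGrading k r) d)
          (fun x => YangBaxter.veroneseGen k r d (v x))
          (YangBaxter.standardRelations k x₁ p)) ∧
      (∃ φ : YangBaxter.YBAlgebra k (YangBaxter.veroneseProlongation k r d v) ≃ₐ[k]
          YangBaxter.veronese (YangBaxter.ybGrading k r) d,
        (∀ x, φ (YangBaxter.ybGen k _ x) = YangBaxter.veroneseGen k r d (v x)) ∧
        ∀ m, (YangBaxter.ybGrading k _ m).map φ.toLinearMap =
          YangBaxter.veroneseGrading (YangBaxter.ybGrading k r) d m) ∧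
      ∃ ν : YangBaxter.YBAlgebra k (YangBaxter.veroneseSolution k r d) →ₐ[k]
          YangBaxter.YBAlgebra k r,
        (∀ w, ν (YangBaxter.ybGen k _ w) = YangBaxter.ybWord k r w.1) ∧
        Function.Injective ν ∧ ν.range = YangBaxter.veronese (YangBaxter.ybGrading k r) d := by
  have hd₀ : d ≠ 0 := by omega
  have hρ := YangBaxter.isLNDIdempotentSolution_veroneseSolution k hx₁ hr hd₀
  let v : X ≃ YangBaxter.NormalWord k r d := YangBaxter.normalWordEquiv k hx₁ hr hd₀
  have hv : ∀ x, (v x).1 = FreeMonoid.of x₁ ^ (d - 1) * FreeMonoid.of x := fun _ => rfl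
  have hv₁ : (v x₁).1 = FreeMonoid.of x₁ ^ d := by
    rw [hv, ← pow_succ, Nat.sub_add_cancel (by omega)]
  have hr' : YangBaxter.IsLNDIdempotentSolution (YangBaxter.veroneseProlongation k r d v) :=
    hρ.transport v
  have hp : ∀ x y, ∃ z, YangBaxter.nor k r ((v x).1 * (v y).1) = (v x₁).1 * (v z).1 := by
    intro x y
    -- The normal form has length 2d, so it is x₁^(2d-1) z = x₁^d · x₁^(d-1) z, which is v₁ followed
    -- by the word of z.
    obtain ⟨z, hz⟩ := YangBaxter.eq_pow_mul_of_of_isNormalMod (m := d + (d - 1)) k hx₁ hr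
      (YangBaxter.nor_normal k r ((v x).1 * (v y).1))
      (by rw [YangBaxter.length_nor, FreeMonoid.length_mul, (v x).2.2, (v y).2.2]; omega)
    exact ⟨z, by rw [hz, hv₁, hv, pow_add, mul_assoc]⟩
  choose p hp using hp
  have hcon : ∀ x y, YangBaxter.wordCon k (YangBaxter.veroneseProlongation k r d v)
      (.of x * .of y) (.of x₁ * .of (p x y)) := by
    intro x y
    refine (YangBaxter.wordCon_flatten_iff hx₁ hr hd₀ v _ _).2 ?_
    rw [YangBaxter.flatten_of_mul_of, YangBaxter.flatten_of_mul_of, ← hp]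
    exact YangBaxter.wordCon_nor k r _
  have hPBW := YangBaxter.isPBWPresentation_ybAlgebra k hx₁ (hρ.transport v) p hcon
  obtain ⟨φ, hφ, hφ'⟩ := YangBaxter.exists_veroneseIsomorphism hx₁ hr hd₀ v
  -- Transport along the identity leaves ρ_d unchanged by definition, so the result for a general
  -- alphabet applies to 𝒩_d itself.
  obtain ⟨ν, hν, hinj, -, hrange⟩ :=
    YangBaxter.exists_veroneseMorphism hx₁ hr hd₀ (Equiv.refl (YangBaxter.NormalWord k r d))
  have hPBW' : YangBaxter.IsPBWPresentation
      (YangBaxter.veroneseGrading (YangBaxter.ybGrading k r) d)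
      (fun x => YangBaxter.veroneseGen k r d (v x)) (YangBaxter.standardRelations k x₁ p) :=
    YangBaxter.IsPBWPresentation.map k hPBW φ hφ hφ'
  exact ⟨hρ, v, hv, hr', ⟨p, hp, hPBW, hPBW'⟩, ⟨φ, hφ, hφ'⟩,
    ν, hν, hinj, hrange⟩
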